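/- Let $\varphi''_F>0$ and $\varphi''_{2F}<0$ be real numbers (the second derivatives of a pair potential at $F$ and $2F$) with $A_F:=\varphi''_F+4\varphi''_{2F}>0$. For integers $N,K$ with $1\le K\le N-2$ put $\varepsilon=1/N$, let $\mathcal U=\{u\in\mathbb R^{2N+1}: u_{-N}=u_N=0\}$, $\langle v,w\rangle=\varepsilon\sum_{\ell=-N+1}^{N}v_\ell w_\ell$ and $\|v\|_{\ell^2_\varepsilon}=\langle v,v\rangle^{1/2}$. For $v\in\mathcal U$, extended by zero, and $|j|\le N-1$ write $(Lv)_j=\varepsilon^{-2}(-v_{j+1}+2v_j-v_{j-1})$ and $(L_2v)_j=\varepsilon^{-2}(-v_{j+2}+2v_j-v_{j-2})$. The linearized force-based operator on $\mathcal U$ is $$(L^{\rm qcf}v)_j=\begin{cases}\varphi''_F(Lv)_j+\varphi''_{2F}(L_2v)_j,&|j|\le K,\\ A_F(Lv)_j,&K<|j|\le N-1,\end{cases}$$ and the linearized quasi-nonlocal operator $L^{\rm qnl}$ on $\mathcal U$ is, for $j\ge0$, $$(L^{\rm qnl}v)_j=\varphi''_F(Lv)_j+\varphi''_{2F}\begin{cases}(L_2v)_j,&0\le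 j\le K-1,\\ (L_2v)_j-(Lv)_{j+1},&j=K,\\ 4(Lv)_j+(Lv)_{j-1},&j=K+1,\\ 4(Lv)_j,&K+2\le j\le N-1,\end{cases}$$ and for $j<0$ the mirror image of this formula under $j\mapsto -j$. For $\alpha\in\mathbb R$ let $G(\alpha)=I-\alpha L^{\rm qcf}$ be the iteration matrix of the Richardson iteration. Operator norms are those induced by the vector norm indicated, ${\rm cond}(S)=\|S\|_{\ell^2_\varepsilon}\|S^{-1}\|_{\ell^2_\varepsilon}$, and $\|v\|_{S^TS}=\langle S^TSv,v\rangle^{1/2}$. Then there is a constant $C>0$, independent of $N$ and $K$ (it may depend on $\varphi''_F$ and $\varphi''_{2F}$), such that for all integers $N,K$ with $1\le K\le N-2$ the following holds. The eigenvalues of $L^{\rm qnl}$, counted with multiplicity, are real and positive, $0<\lambda_1^{\rm qnl}\le\dots\le\lambda_{2N-1}^{\rm qnl}$, and there is an invertible matrix $S$ with $$L^{\rm qcf}=S^{-1}\,{\rm diag}(\lambda_1^{\rm qnl},\dots,\lambda_{2N-1}^{\rm qnl})\,S,\qquad {\rm cond}(S)\le C,$$ such that: 1. for every $\alpha\in\mathbb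 R$, $\ \|G(\alpha)\|_{S^TS}=\max_j|1-\alpha\lambda_j^{\rm qnl}|\ $ and $\ \|G(\alpha)\|_{\ell^2_\varepsilon}\le{\rm cond}(S)\max_j|1-\alpha\lambda^{\rm qnl}_j|\le C\max_j|1-\alpha\lambda_j^{\rm qnl}|$; 2. for $\alpha\in\mathbb R$, $G(\alpha)$ is a contraction in the $S^TS$-norm, i.e. $\|G(\alpha)\|_{S^TS}<1$, if and only if $0<\alpha<2/\lambda^{\rm qnl}_{2N-1}$; moreover $\|G(\alpha)\|_{\ell^2_\varepsilon}<1$ implies $0<\alpha<2/\lambda^{\rm qnl}_{2N-1}$; 3. $\alpha_{\rm opt}=2/(\lambda^{\rm qnl}_1+\lambda^{\rm qnl}_{2N-1})$ minimizes $\|G(\alpha)\|_{S^TS}$ over $\alpha\in\mathbb R$, with minimum $q=\dfrac{\lambda^{\rm qnl}_{2N-1}-\lambda^{\rm qnl}_1}{\lambda^{\rm qnl}_{2N-1}+\lambda^{\rm qnl}_1}$, and $$\|G(\alpha_{\rm opt})\|_{\ell^2_\varepsilon}\le C\,q,\qquad \|G(\alpha_{\rm opt})\|_{\ell^2_\varepsilon}\le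 C\Big(1-\frac{2A_F\varepsilon^2}{\varphi''_F}\Big),\qquad 1-C\varepsilon^2\le q\le 1-\frac{A_F\varepsilon^2}{2\varphi''_F}.$$ -/

import Mathlib

noncomputable section

/-- The lattice spacing `ε = 1 / N`. -/
def latticeEps (N : ℕ) : ℝ := 1 / (N : ℝ)

/-- The displacement space `{u ∈ ℝ^{2N+1} : u_{-N} = u_N = 0}`, written through the values at the
`2N - 1` free atoms `j = -N+1, …, N-1`; the entry with index `i` belongs to the atom
`chainSite N i = i + 1 - N`. -/
abbrev ChainDisp (N : ℕ) : Type := Fin (2 * N - 1) → ℝ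

def chainSite (N : ℕ) (i : Fin (2 * N - 1)) : ℤ := (i : ℤ) + 1 - (N : ℤ)

/-- The value `v_j` of a displacement at the atom `j`; it is `0` at `j = ±N` and beyond. -/
def chainVal (N : ℕ) (v : ChainDisp N) (j : ℤ) : ℝ :=
  if h : -(N : ℤ) < j ∧ j < (N : ℤ) then v ⟨(j + (N : ℤ) - 1).toNat, by omega⟩ else 0

theorem chainVal_add (N : ℕ) (v w : ChainDisp N) (j : ℤ) :
    chainVal N (v + w) j = chainVal N v j + chainVal N w j := by
  unfold chainVal; split <;> simp

theorem chainVal_smul (N : ℕ) (c : ℝ) (v : ChainDisp N) (j : ℤ) :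
    chainVal N (c • v) j = c * chainVal N v j := by
  unfold chainVal; split <;> simp

theorem chainVal_site (N : ℕ) (v : ChainDisp N) (i : Fin (2 * N - 1)) :
    chainVal N v (chainSite N i) = v i := by
  have h1 := i.isLt
  unfold chainVal chainSite
  rw [dif_pos (by constructor <;> omega)]
  congr 1
  ext
  simp

/-- The nearest neighbour stencil `(-w_{j+1} + 2 w_j - w_{j-1}) / ε²`. -/
def nnStencil (N : ℕ) (w : ℤ → ℝ) (j : ℤ) : ℝ :=
  (-w (j + 1) + 2 * w j - w (j - 1)) / latticeEps N ^ 2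

/-- The next-nearest neighbour stencil `(-w_{j+2} + 2 w_j - w_{j-2}) / ε²`. -/
def nnnStencil (N : ℕ) (w : ℤ → ℝ) (j : ℤ) : ℝ :=
  (-w (j + 2) + 2 * w j - w (j - 2)) / latticeEps N ^ 2

/-- The continuum elastic modulus `A_F = φ''_F + 4 φ''_{2F}`. Here and below `phiF` stands for
`φ''_F = φ''(F)` and `phi2F` for `φ''_{2F} = φ''(2F)`. -/
def elasticModulus (phiF phi2F : ℝ) : ℝ := phiF + 4 * phi2F

/-- The linearized atomistic operator at the atom `j`. -/
def atomisticStencil (phiF phi2F : ℝ) (N : ℕ) (w : ℤ → ℝ) (j : ℤ) : ℝ :=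
  phiF * nnStencil N w j + phi2F * nnnStencil N w j

/-- The linearized local quasicontinuum operator `A_F L` at the atom `j`. -/
def qclStencil (phiF phi2F : ℝ) (N : ℕ) (w : ℤ → ℝ) (j : ℤ) : ℝ :=
  elasticModulus phiF phi2F * nnStencil N w j

/-- The linearized force-based quasicontinuum operator at the atom `j`, with the atomistic region
`{-K, …, K}`. -/
def qcfStencil (phiF phi2F : ℝ) (N K : ℕ) (w : ℤ → ℝ) (j : ℤ) : ℝ :=
  if |j| ≤ (K : ℤ) then atomisticStencil phiF phi2F N w j else qclStencil phiF phi2F N w j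

/-- The linearized quasi-nonlocal quasicontinuum operator at an atom `j ≥ 0`. -/
def qnlStencilRight (phiF phi2F : ℝ) (N K : ℕ) (w : ℤ → ℝ) (j : ℤ) : ℝ :=
  phiF * nnStencil N w j + phi2F *
    (if j ≤ (K : ℤ) - 1 then nnnStencil N w j
     else if j = (K : ℤ) then nnnStencil N w j - nnStencil N w (j + 1)
     else if j = (K : ℤ) + 1 then 4 * nnStencil N w j + nnStencil N w (j - 1)
     else 4 * nnStencil N w j)

/-- The linearized quasi-nonlocal quasicontinuum operator; the formula for `j < 0` is the mirror
image (under `j ↦ -j`) of the one for `j > 0`. -/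
def qnlStencil (phiF phi2F : ℝ) (N K : ℕ) (w : ℤ → ℝ) (j : ℤ) : ℝ :=
  if 0 ≤ j then qnlStencilRight phiF phi2F N K w j
  else qnlStencilRight phiF phi2F N K (fun l => w (-l)) (-j)

/-- `L^qcf` as a linear operator on the displacement space. -/
def qcfOperator (phiF phi2F : ℝ) (N K : ℕ) : ChainDisp N →ₗ[ℝ] ChainDisp N where
  toFun v i := qcfStencil phiF phi2F N K (chainVal N v) (chainSite N i)
  map_add' v w := by
    ext i
    simp only [qcfStencil, atomisticStencil, qclStencil, nnStencil, nnnStencil, chainVal_add,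
      Pi.add_apply]
    split <;> ring
  map_smul' c v := by
    ext i
    simp only [qcfStencil, atomisticStencil, qclStencil, nnStencil, nnnStencil, chainVal_smul,
      Pi.smul_apply, smul_eq_mul, RingHom.id_apply]
    split <;> ring

/-- `L^qnl` as a linear operator on the displacement space. -/
def qnlOperator (phiF phi2F : ℝ) (N K : ℕ) : ChainDisp N →ₗ[ℝ] ChainDisp N where
  toFun v i := qnlStencil phiF phi2F N K (chainVal N v) (chainSite N i)
  map_add' v w := by
    ext i
    simp only [qnlStencil, qnlStencilRight, nnStencil, nnnStencil, chainVal_add, Pi.add_apply]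
    split_ifs <;> ring
  map_smul' c v := by
    ext i
    simp only [qnlStencil, qnlStencilRight, nnStencil, nnnStencil, chainVal_smul, Pi.smul_apply,
      smul_eq_mul, RingHom.id_apply]
    split_ifs <;> ring

abbrev ChainMatrix (N : ℕ) : Type := Matrix (Fin (2 * N - 1)) (Fin (2 * N - 1)) ℝ

/-- The matrix of `L^qcf`. -/
def qcfMatrix (phiF phi2F : ℝ) (N K : ℕ) : ChainMatrix N :=
  LinearMap.toMatrix' (qcfOperator phiF phi2F N K)

/-- The matrix of `L^qnl`. -/
def qnlMatrix (phiF phi2F : ℝ) (N K : ℕ) : ChainMatrix N :=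
  LinearMap.toMatrix' (qnlOperator phiF phi2F N K)

/-- The iteration matrix `G = I - α L^qcf` of the Richardson iteration. -/
def richardsonMatrix (phiF phi2F : ℝ) (N K : ℕ) (α : ℝ) : ChainMatrix N :=
  1 - α • qcfMatrix phiF phi2F N K

/-- `⟨v, w⟩ = ε ∑_ℓ v_ℓ w_ℓ`. -/
def epsInner (N : ℕ) (v w : ChainDisp N) : ℝ := latticeEps N * ∑ i, v i * w i

/-- The `ℓ²_ε` norm. -/
def epsNorm (N : ℕ) (v : ChainDisp N) : ℝ := Real.sqrt (epsInner N v v)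

/-- The `A`-norm `‖v‖_A = ⟨A v, v⟩^{1/2}` of a symmetric positive definite matrix `A`. -/
def energyNorm (N : ℕ) (A : ChainMatrix N) (v : ChainDisp N) : ℝ :=
  Real.sqrt (epsInner N (A.mulVec v) v)

/-- The operator norm `sup_{v ≠ 0} ‖M v‖ / ‖v‖` for a given vector norm `nrm`. -/
def opNormOf (N : ℕ) (nrm : ChainDisp N → ℝ) (M : ChainMatrix N) : ℝ :=
  sSup {r : ℝ | ∃ v : ChainDisp N, v ≠ 0 ∧ r = nrm (M.mulVec v) / nrm v}

/-- The condition number with respect to the `ℓ²_ε` norm. -/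
def epsCond (N : ℕ) (M : ChainMatrix N) : ℝ :=
  opNormOf N (epsNorm N) M * opNormOf N (epsNorm N) M⁻¹

/-- `lam 0 ≤ lam 1 ≤ …` are the eigenvalues of `M`, all of them real, in increasing order and
counted with multiplicity. -/
def IsOrderedSpectrum (N : ℕ) (M : ChainMatrix N) (lam : Fin (2 * N - 1) → ℝ) : Prop :=
  Monotone lam ∧ M.charpoly = ∏ i, (Polynomial.X - Polynomial.C (lam i))

end

open Matrix
open scoped Matrix.Norms.L2Operator

noncomputable section

/-! Let `T` be the unscaled Dirichlet second difference, `X` the projection onto the atomistic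
region, `p = A_F` and `m = -φ''_{2F} > 0`. Since `ε² L_2 = 4T - T²`, both operators factor through
`B = p + m X T`: `L^qcf = ε⁻² B T` (`qcfMatrix_eq`) and `L^qnl = ε⁻² T B` (`qnlMatrix_eq`). Hence
`L^qcf = B L^qnl B⁻¹`, while `L^qnl = ε⁻² (p T + m T X T)` is symmetric. If `L^qnl = Qᵀ Λ Q` with
`Q` orthogonal, then `S = Q B⁻¹` diagonalizes `L^qcf`, and `cond S ≤ ‖B‖ ‖B⁻¹‖`. Here `‖B‖ ≤ p + 4m
= φ''_F`, and `dotProduct_self_le_of_one_add_proj_mul` bounds `B⁻¹` uniformly in `N` and `K`.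

In the `SᵀS`-norm the iteration matrix acts as the diagonal matrix `1 - αΛ`, so its norm is governed
by the two extreme eigenvalues and the optimal `α` is found by elementary algebra. The rates follow
from `ε⁻² p T ≤ L^qnl ≤ ε⁻² φ''_F T` (`qnl_form_bounds`), from `2ε² ≤ T ≤ 4`, and from two test
vectors showing `λ_1 ≤ 3φ''_F` and `λ_{2N-1} ≥ 2p ε⁻²`. -/

/-! ### Weighted norms, spectral norms and orthogonal diagonalization. -/

theorem norm_toLp_sq {ι : Type*} [Fintype ι] (v : ι → ℝ) :
    ‖WithLp.toLp 2 v‖ ^ 2 = v ⬝ᵥ v := by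
  rw [EuclideanSpace.real_norm_sq_eq]
  simp [dotProduct, sq]

theorem norm_toLp_pos {ι : Type*} [Fintype ι] {v : ι → ℝ} (hv : v ≠ 0) :
    0 < ‖WithLp.toLp 2 v‖ := by
  rw [norm_pos_iff]
  simpa using hv

theorem norm_toLp_mulVec_le {ι : Type*} [Fintype ι] [DecidableEq ι] (M : Matrix ι ι ℝ)
    (v : ι → ℝ) : ‖WithLp.toLp 2 (M *ᵥ v)‖ ≤ ‖M‖ * ‖WithLp.toLp 2 v‖ :=
  M.l2_opNorm_mulVec (WithLp.toLp 2 v)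

theorem l2_opNorm_le_of_dotProduct_le {ι : Type*} [Fintype ι] [DecidableEq ι]
    (M : Matrix ι ι ℝ) {c : ℝ} (hc : 0 ≤ c)
    (h : ∀ v, (M *ᵥ v) ⬝ᵥ (M *ᵥ v) ≤ c ^ 2 * (v ⬝ᵥ v)) : ‖M‖ ≤ c := by
  rw [Matrix.cstar_norm_def]
  refine ContinuousLinearMap.opNorm_le_bound _ hc fun x => ?_
  refine le_of_sq_le_sq ?_ (by positivity)
  have := h x.ofLp
  rw [← norm_toLp_sq, ← norm_toLp_sq, ← mul_pow] at this
  exact this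

theorem l2_opNorm_le_one_of_transpose_mul_self {ι : Type*} [Fintype ι] [DecidableEq ι]
    {Q : Matrix ι ι ℝ} (h : Qᵀ * Q = 1) : ‖Q‖ ≤ 1 := by
  refine l2_opNorm_le_of_dotProduct_le Q zero_le_one fun v => ?_
  rw [dotProduct_mulVec, vecMul_mulVec, h]
  simp

theorem latticeEps_pos {N : ℕ} (hN : 0 < N) : 0 < latticeEps N := by
  unfold latticeEps; positivity

theorem epsNorm_eq (N : ℕ) (v : ChainDisp N) :
    epsNorm N v = √(latticeEps N) * ‖WithLp.toLp 2 v‖ := by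
  have h0 : 0 ≤ latticeEps N := by unfold latticeEps; positivity
  have : epsInner N v v = latticeEps N * ‖WithLp.toLp 2 v‖ ^ 2 := by
    rw [norm_toLp_sq]; rfl
  rw [epsNorm, this, Real.sqrt_mul h0, Real.sqrt_sq (norm_nonneg _)]

theorem epsNorm_div_epsNorm {N : ℕ} (hN : 0 < N) (v w : ChainDisp N) :
    epsNorm N v / epsNorm N w = ‖WithLp.toLp 2 v‖ / ‖WithLp.toLp 2 w‖ := by
  rw [epsNorm_eq, epsNorm_eq]
  exact mul_div_mul_left _ _ (Real.sqrt_pos.2 (latticeEps_pos hN)).ne'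

theorem opNormOf_epsNorm {N : ℕ} (hN : 0 < N) (M : ChainMatrix N) :
    opNormOf N (epsNorm N) M = ‖M‖ := by
  have hb : ∀ r ∈ {r : ℝ | ∃ v : ChainDisp N, v ≠ 0 ∧
      r = epsNorm N (M.mulVec v) / epsNorm N v}, r ≤ ‖M‖ := by
    rintro r ⟨v, hv, rfl⟩
    rw [epsNorm_div_epsNorm hN, div_le_iff₀ (norm_toLp_pos hv)]
    exact norm_toLp_mulVec_le M v
  refine le_antisymm (Real.sSup_le hb (norm_nonneg _)) ?_
  rw [Matrix.cstar_norm_def]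
  refine ContinuousLinearMap.opNorm_le_bound _ (Real.sSup_nonneg ?_) fun x => ?_
  · rintro r ⟨v, hv, rfl⟩
    rw [epsNorm_div_epsNorm hN]
    positivity
  · rcases eq_or_ne x 0 with rfl | hx
    · simp
    · have hx' : x.ofLp ≠ 0 := by simpa using hx
      rw [← div_le_iff₀ (norm_pos_iff.2 hx)]
      refine le_csSup ⟨_, hb⟩ ⟨x.ofLp, hx', ?_⟩
      rw [epsNorm_div_epsNorm hN]
      rfl

theorem energyNorm_transpose_mul_self (N : ℕ) (S : ChainMatrix N) (v : ChainDisp N) :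
    energyNorm N (S.transpose * S) v = epsNorm N (S *ᵥ v) := by
  have : ((Sᵀ * S) *ᵥ v) ⬝ᵥ v = (S *ᵥ v) ⬝ᵥ (S *ᵥ v) := by
    rw [dotProduct_comm, ← mulVec_mulVec, dotProduct_mulVec, vecMul_transpose]
  unfold energyNorm epsNorm epsInner
  exact congrArg (fun t => √(latticeEps N * t)) this

/-- `S` maps the `SᵀS`-norm isometrically onto the `ℓ²_ε`-norm; substituting `S v` for `v` turns `M`
into its conjugate. -/
theorem opNormOf_energyNorm {N : ℕ} (hN : 0 < N) {S : ChainMatrix N} (hS : IsUnit S.det)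
    (M : ChainMatrix N) :
    opNormOf N (energyNorm N (S.transpose * S)) M = ‖S * M * S⁻¹‖ := by
  rw [← opNormOf_epsNorm hN]
  unfold opNormOf
  congr 1
  ext r
  simp only [energyNorm_transpose_mul_self, Set.mem_ofPred_eq]
  constructor
  · rintro ⟨v, hv, rfl⟩
    refine ⟨S *ᵥ v, fun h => hv ?_, ?_⟩
    · rw [← one_mulVec v, ← nonsing_inv_mul S hS, ← mulVec_mulVec, h, mulVec_zero]
    · rw [mulVec_mulVec, mulVec_mulVec, mul_assoc, nonsing_inv_mul S hS, mul_one]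
  · rintro ⟨v, hv, rfl⟩
    refine ⟨S⁻¹ *ᵥ v, fun h => hv ?_, ?_⟩
    · rw [← one_mulVec v, ← mul_nonsing_inv S hS, ← mulVec_mulVec, h, mulVec_zero]
    · rw [mulVec_mulVec, mulVec_mulVec, mulVec_mulVec, mul_nonsing_inv S hS, one_mulVec]

theorem iSup_abs_eq_norm {ι : Type*} [Fintype ι] [Nonempty ι] (d : ι → ℝ) :
    ⨆ j, |d j| = ‖d‖ := by
  refine le_antisymm (ciSup_le fun j => norm_le_pi_norm d j) ?_
  refine (pi_norm_le_iff_of_nonempty d).2 fun j => ?_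
  exact le_ciSup (f := fun j => |d j|) (Set.finite_range _).bddAbove j

theorem exists_monotone_orthogonal_diagonalization {n : ℕ} {H : Matrix (Fin n) (Fin n) ℝ}
    (hH : H.IsSymm) :
    ∃ (lam : Fin n → ℝ) (Q : Matrix (Fin n) (Fin n) ℝ), Monotone lam ∧
      Qᵀ * Q = 1 ∧ Q * Qᵀ = 1 ∧ H = Qᵀ * diagonal lam * Q := by
  have hH' : H.IsHermitian := by
    rw [IsHermitian, conjTranspose_eq_transpose_of_trivial]; exact hH
  set σ := Tuple.sort hH'.eigenvalues
  set U : Matrix (Fin n) (Fin n) ℝ := hH'.eigenvectorUnitary.val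
  have hU : U * Uᵀ = 1 := by
    rw [← conjTranspose_eq_transpose_of_trivial]
    exact Unitary.coe_mul_star_self hH'.eigenvectorUnitary
  have hQ : (U.submatrix id σ) * (U.submatrix id σ)ᵀ = 1 := by
    rw [transpose_submatrix, submatrix_mul_equiv, hU]; simp
  refine ⟨hH'.eigenvalues ∘ σ, (U.submatrix id σ)ᵀ, Tuple.monotone_sort _, by simpa using hQ,
    mul_eq_one_comm.1 (by simpa using hQ), ?_⟩
  have hd : diagonal (hH'.eigenvalues ∘ σ) = (diagonal hH'.eigenvalues).submatrix σ σ := by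
    rw [submatrix_diagonal_equiv]
  rw [hd, transpose_transpose, transpose_submatrix, submatrix_mul_equiv, submatrix_mul_equiv]
  conv_lhs => rw [hH'.spectral_theorem]
  simp [Unitary.conjStarAlgAut_apply, star_eq_conjTranspose, U]

/-! ### Factorization of the two operators through the second difference. -/

/-- The unscaled second difference with homogeneous Dirichlet conditions. -/
def secondDiffOperator (N : ℕ) : ChainDisp N →ₗ[ℝ] ChainDisp N where
  toFun v i := -chainVal N v (chainSite N i + 1) + 2 * chainVal N v (chainSite N i)
    - chainVal N v (chainSite N i - 1)
  map_add' v w := by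
    ext i
    simp only [chainVal_add, Pi.add_apply]
    ring
  map_smul' c v := by
    ext i
    simp only [chainVal_smul, Pi.smul_apply, smul_eq_mul, RingHom.id_apply]
    ring

/-- The matrix of the unscaled second difference. -/
def secondDiff (N : ℕ) : ChainMatrix N := LinearMap.toMatrix' (secondDiffOperator N)

/-- The projection onto the atomistic region `{-K, …, K}`. -/
def atomisticProj (N K : ℕ) : ChainMatrix N :=
  diagonal fun i => if |chainSite N i| ≤ (K : ℤ) then 1 else 0

theorem secondDiff_mulVec (N : ℕ) (v : ChainDisp N) (i : Fin (2 * N - 1)) :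
    (secondDiff N *ᵥ v) i = -chainVal N v (chainSite N i + 1) + 2 * chainVal N v (chainSite N i)
      - chainVal N v (chainSite N i - 1) := by
  rw [secondDiff, LinearMap.toMatrix'_mulVec]; rfl

theorem chainVal_eq_zero {N : ℕ} (v : ChainDisp N) {j : ℤ} (h : ¬(-(N : ℤ) < j ∧ j < N)) :
    chainVal N v j = 0 := dif_neg h

theorem exists_chainSite_eq {N : ℕ} {j : ℤ} (h : -(N : ℤ) < j ∧ j < N) :
    ∃ i, chainSite N i = j :=
  ⟨⟨(j + N - 1).toNat, by omega⟩, by simp only [chainSite]; omega⟩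

theorem chainVal_secondDiff {N : ℕ} (v : ChainDisp N) {j : ℤ} (h : -(N : ℤ) < j ∧ j < N) :
    chainVal N (secondDiff N *ᵥ v) j
      = -chainVal N v (j + 1) + 2 * chainVal N v j - chainVal N v (j - 1) := by
  obtain ⟨i, rfl⟩ := exists_chainSite_eq h
  rw [chainVal_site, secondDiff_mulVec]

theorem chainVal_atomisticProj {N K : ℕ} (hKN : K + 1 ≤ N) (v : ChainDisp N) (j : ℤ) :
    chainVal N (atomisticProj N K *ᵥ v) j = if |j| ≤ (K : ℤ) then chainVal N v j else 0 := by
  by_cases h : -(N : ℤ) < j ∧ j < N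
  · obtain ⟨i, rfl⟩ := exists_chainSite_eq h
    rw [chainVal_site, chainVal_site, atomisticProj, mulVec_diagonal]
    split_ifs <;> simp
  · rw [chainVal_eq_zero _ h, if_neg]
    rw [abs_le]; omega

theorem secondDiff_isSymm (N : ℕ) : (secondDiff N).IsSymm := by
  have hs : ∀ (i : Fin (2 * N - 1)) (j : ℤ),
      chainVal N (Pi.single i 1) j = if j = chainSite N i then 1 else 0 := by
    intro i j
    by_cases h : -(N : ℤ) < j ∧ j < N
    · obtain ⟨k, rfl⟩ := exists_chainSite_eq h
      rw [chainVal_site, Pi.single_apply]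
      have : k = i ↔ chainSite N k = chainSite N i := by
        simp only [chainSite, Fin.ext_iff]; omega
      simp only [this]
    · rw [chainVal_eq_zero _ h, if_neg]
      have := i.isLt
      simp only [chainSite]; omega
  ext i j
  rw [transpose_apply]
  simp only [secondDiff, LinearMap.toMatrix'_apply, secondDiffOperator, LinearMap.coe_mk,
    AddHom.coe_mk]
  simp only [hs]
  split_ifs <;> first | (exfalso; omega) | norm_num

/-- Rests on `-v_{j+2} + 2v_j - v_{j-2} = 4(Tv)_j - (T²v)_j`. The gap `K + 2 ≤ N` keeps `j ± 1` at
free atoms whenever `|j| ≤ K`, so the boundary does not disturb `T²` there. -/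
theorem qcfMatrix_eq (phiF phi2F : ℝ) {N K : ℕ} (hKN : K + 2 ≤ N) :
    qcfMatrix phiF phi2F N K = (N : ℝ) ^ 2 •
      ((elasticModulus phiF phi2F • 1 + (-phi2F) • (atomisticProj N K * secondDiff N))
        * secondDiff N) := by
  refine Matrix.toLin'.injective (LinearMap.ext fun v => funext fun i => ?_)
  have h1 := i.isLt
  have hT := chainVal_site N (secondDiff N *ᵥ v) i
  rw [toLin'_apply, toLin'_apply, smul_mulVec, add_mul, smul_mul_assoc, smul_mul_assoc, one_mul,
    add_mulVec, smul_mulVec, smul_mulVec, mul_assoc, ← mulVec_mulVec, ← mulVec_mulVec, qcfMatrix,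
    LinearMap.toMatrix'_mulVec]
  simp only [Pi.smul_apply, Pi.add_apply, smul_eq_mul]
  rw [← chainVal_site N (atomisticProj N K *ᵥ _) i, chainVal_atomisticProj (by omega),
    ← chainVal_site N (secondDiff N *ᵥ v) i]
  simp only [qcfOperator, LinearMap.coe_mk, AddHom.coe_mk, qcfStencil, atomisticStencil,
    qclStencil, nnStencil, nnnStencil, latticeEps, elasticModulus]
  generalize hj : chainSite N i = j
  have hj' : -(N : ℤ) < j ∧ j < N := by rw [← hj, chainSite]; omega
  rw [chainVal_secondDiff v hj']
  split_ifs with hK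
  · rw [abs_le] at hK
    rw [chainVal_secondDiff _ hj', chainVal_secondDiff _ (by omega), chainVal_secondDiff _ hj',
      chainVal_secondDiff _ (by omega)]
    rw [show j + 1 + 1 = j + 2 by ring, show j - 1 - 1 = j - 2 by ring, add_sub_cancel_right,
      sub_add_cancel]
    simp only [one_div, inv_pow, div_inv_eq_mul]
    ring
  · simp only [one_div, inv_pow, div_inv_eq_mul]
    ring

/-- The same factors in the opposite order. The special interface rows at `±K` and `±(K+1)` are what
the outer `T` produces when it meets the cutoff of `X T v`. -/
theorem qnlMatrix_eq (phiF phi2F : ℝ) {N K : ℕ} (hK1 : 1 ≤ K) (hKN : K + 2 ≤ N) :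
    qnlMatrix phiF phi2F N K = (N : ℝ) ^ 2 • (secondDiff N *
      (elasticModulus phiF phi2F • 1 + (-phi2F) • (atomisticProj N K * secondDiff N))) := by
  refine Matrix.toLin'.injective (LinearMap.ext fun v => funext fun i => ?_)
  have h1 := i.isLt
  rw [toLin'_apply, toLin'_apply, smul_mulVec, mul_add, mul_smul_comm, mul_smul_comm, mul_one,
    add_mulVec, smul_mulVec, smul_mulVec, ← mulVec_mulVec, ← mulVec_mulVec, qnlMatrix,
    LinearMap.toMatrix'_mulVec]
  simp only [Pi.smul_apply, Pi.add_apply, smul_eq_mul]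
  rw [secondDiff_mulVec _ (atomisticProj N K *ᵥ _)]
  simp only [chainVal_atomisticProj (show K + 1 ≤ N by omega), secondDiff_mulVec]
  simp only [qnlOperator, LinearMap.coe_mk, AddHom.coe_mk, qnlStencil, qnlStencilRight,
    nnStencil, nnnStencil, latticeEps, elasticModulus]
  generalize hj : chainSite N i = j
  have hj' : -(N : ℤ) < j ∧ j < N := by rw [← hj, chainSite]; omega
  have e : ∀ l : ℤ, |l| ≤ (K : ℤ) → chainVal N (secondDiff N *ᵥ v) l
      = -chainVal N v (l + 1) + 2 * chainVal N v l - chainVal N v (l - 1) := fun l hl =>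
    chainVal_secondDiff v (by rw [abs_le] at hl; omega)
  have e' : ∀ l : ℤ, (if |l| ≤ (K : ℤ) then chainVal N (secondDiff N *ᵥ v) l else 0)
      = if |l| ≤ (K : ℤ) then
        -chainVal N v (l + 1) + 2 * chainVal N v l - chainVal N v (l - 1) else 0 := fun l => by
    split_ifs with h
    · exact e l h
    · rfl
  simp only [e']
  simp only [abs_le, one_div, inv_pow, div_inv_eq_mul]
  have a1 : -(-j + 1) = j - 1 := by ring
  have a2 : -(-j - 1) = j + 1 := by ring
  have a3 : -(-j + 2) = j - 2 := by ring
  have a4 : -(-j - 2) = j + 2 := by ring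
  have a5 : -(-j + 1 + 1) = j - 2 := by ring
  have a6 : -(-j - 1 - 1) = j + 2 := by ring
  have a9 : j + 1 + 1 = j + 2 := by ring
  have a10 : j - 1 - 1 = j - 2 := by ring
  simp only [a1, a2, a3, a4, a5, a6, a9, a10, neg_neg, add_sub_cancel_right,
    sub_add_cancel]
  split_ifs <;> first | (exfalso; omega) | ring

/-! ### Spectral bounds for the second difference. -/

/-- Discrete Picone inequality. With `f = w g`, the difference of the two sides is a sum of terms
`w_k w_{k+1} (g_{k+1} - g_k)²`; the left side is the boundary term left by the telescoping. A
positive `w` with `-Δw ≥ c w` thus gives the lower bound `c` for the form. -/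
theorem sum_secondDiff_ge (f w : ℕ → ℝ) (hf : f 0 = 0) (hw0 : 0 ≤ w 0) (n : ℕ)
    (hw : ∀ k, 1 ≤ k → k ≤ n → 0 < w k) :
    f n ^ 2 * w (n + 1) / w n - f n * f (n + 1) ≤
      ∑ i ∈ Finset.range n, (f (i + 1) * (-f (i + 2) + 2 * f (i + 1) - f i)
        - f (i + 1) ^ 2 * ((-w (i + 2) + 2 * w (i + 1) - w i) / w (i + 1))) := by
  induction n with
  | zero => simp [hf]
  | succ n ih =>
    rw [Finset.sum_range_succ]
    have ih' := ih fun k h1 h2 => hw k h1 (by omega)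
    have h1 := hw (n + 1) (by omega) le_rfl
    have key : 0 ≤ f n ^ 2 * w (n + 1) / w n - 2 * (f n * f (n + 1))
        + f (n + 1) ^ 2 * w n / w (n + 1) := by
      -- The case `n = 0` is separate because `w 0` may vanish; there `f 0 = 0` removes the other
      -- terms.
      rcases Nat.eq_zero_or_pos n with rfl | hn
      · simp only [hf]
        have : 0 ≤ f (0 + 1) ^ 2 * w 0 / w (0 + 1) := by positivity
        simpa using this
      · have h0 := hw n hn (by omega)
        have : f n ^ 2 * w (n + 1) / w n - 2 * (f n * f (n + 1))
            + f (n + 1) ^ 2 * w n / w (n + 1)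
            = (f n * w (n + 1) - f (n + 1) * w n) ^ 2 / (w n * w (n + 1)) := by
          field_simp
          ring
        rw [this]
        positivity
    have e : f (n + 1) ^ 2 * ((-w (n + 2) + 2 * w (n + 1) - w n) / w (n + 1))
        = 2 * f (n + 1) ^ 2 - f (n + 1) ^ 2 * w (n + 2) / w (n + 1)
          - f (n + 1) ^ 2 * w n / w (n + 1) := by
      field_simp
      ring
    rw [e]
    rw [show n + 1 + 1 = n + 2 from rfl]
    linarith

/-- Up to boundary terms, `4 ∑ f²` exceeds the form by the sum of the squares `(f_k + f_{k+1})²`. -/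
theorem sum_secondDiff_le (f : ℕ → ℝ) (hf : f 0 = 0) (n : ℕ) :
    ∑ i ∈ Finset.range n, f (i + 1) * (-f (i + 2) + 2 * f (i + 1) - f i) ≤
      4 * ∑ i ∈ Finset.range n, f (i + 1) ^ 2 - f n ^ 2 - f n * f (n + 1) := by
  induction n with
  | zero => simp [hf]
  | succ n ih =>
    rw [Finset.sum_range_succ, Finset.sum_range_succ, show n + 1 + 1 = n + 2 from rfl]
    nlinarith [sq_nonneg (f n + f (n + 1))]

theorem chainVal_natCast_sub (N : ℕ) (v : ChainDisp N) (i : Fin (2 * N - 1)) :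
    chainVal N v (((i + 1 : ℕ) : ℤ) - N) = v i := by
  rw [← chainVal_site N v i, chainSite]; push_cast; rfl

theorem dotProduct_secondDiff (N : ℕ) (v : ChainDisp N) :
    v ⬝ᵥ (secondDiff N *ᵥ v) = ∑ i ∈ Finset.range (2 * N - 1),
      chainVal N v (((i + 1 : ℕ) : ℤ) - N) * (-chainVal N v (((i + 2 : ℕ) : ℤ) - N)
        + 2 * chainVal N v (((i + 1 : ℕ) : ℤ) - N) - chainVal N v ((i : ℤ) - N)) := by
  rw [← Fin.sum_univ_eq_sum_range (fun i =>
    chainVal N v (((i + 1 : ℕ) : ℤ) - N) * (-chainVal N v (((i + 2 : ℕ) : ℤ) - N)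
        + 2 * chainVal N v (((i + 1 : ℕ) : ℤ) - N) - chainVal N v ((i : ℤ) - N))), dotProduct]
  refine Finset.sum_congr rfl fun i _ => ?_
  rw [secondDiff_mulVec, chainVal_natCast_sub, chainVal_site,
    show chainSite N i + 1 = ((i + 2 : ℕ) : ℤ) - N by simp only [chainSite]; push_cast; ring,
    show chainSite N i - 1 = (i : ℤ) - N by simp only [chainSite]; ring]

theorem dotProduct_self_chainDisp (N : ℕ) (v : ChainDisp N) :
    v ⬝ᵥ v = ∑ i ∈ Finset.range (2 * N - 1), chainVal N v (((i + 1 : ℕ) : ℤ) - N) ^ 2 := by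
  rw [← Fin.sum_univ_eq_sum_range (fun i => chainVal N v (((i + 1 : ℕ) : ℤ) - N) ^ 2), dotProduct]
  refine Finset.sum_congr rfl fun i _ => ?_
  rw [chainVal_natCast_sub, sq]

theorem dotProduct_secondDiff_le {N : ℕ} (hN : 0 < N) (v : ChainDisp N) :
    v ⬝ᵥ (secondDiff N *ᵥ v) ≤ 4 * (v ⬝ᵥ v) := by
  rw [dotProduct_secondDiff, dotProduct_self_chainDisp]
  have h := sum_secondDiff_le (fun k => chainVal N v ((k : ℤ) - N))
    (chainVal_eq_zero v (by simp)) (2 * N - 1)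
  have h0 : chainVal N v (((2 * N - 1 + 1 : ℕ) : ℤ) - N) = 0 := chainVal_eq_zero v (by omega)
  simp only [h0] at h
  nlinarith [sq_nonneg (chainVal N v (((2 * N - 1 : ℕ) : ℤ) - N))]

theorem le_dotProduct_secondDiff {N : ℕ} (hN : 0 < N) (v : ChainDisp N) :
    2 / (N : ℝ) ^ 2 * (v ⬝ᵥ v) ≤ v ⬝ᵥ (secondDiff N *ᵥ v) := by
  rw [dotProduct_secondDiff, dotProduct_self_chainDisp]
  -- This parabola has second difference exactly `2` and maximum `N²`, so `-Δw / w ≥ 2 / N²`.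
  set w : ℕ → ℝ := fun k => (k : ℝ) * (2 * N - k) with hw
  have hpos : ∀ k, 1 ≤ k → k ≤ 2 * N - 1 → 0 < w k := fun k h1 h2 => by
    have h1' : (1 : ℝ) ≤ k := by exact_mod_cast h1
    have h2' : (k : ℝ) + 1 ≤ 2 * N := by
      have : k + 1 ≤ 2 * N := by omega
      exact_mod_cast this
    exact mul_pos (by linarith) (by linarith)
  have h := sum_secondDiff_ge (fun k => chainVal N v ((k : ℤ) - N)) w
    (chainVal_eq_zero v (by simp)) (by simp [hw]) (2 * N - 1) hpos
  have h0 : chainVal N v (((2 * N - 1 + 1 : ℕ) : ℤ) - N) = 0 := chainVal_eq_zero v (by omega)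
  have hw1 : w (2 * N - 1 + 1) = 0 := by
    rw [show 2 * N - 1 + 1 = 2 * N by omega]; simp [hw]
  simp only [h0, hw1, mul_zero, zero_div, sub_zero] at h
  rw [Finset.sum_sub_distrib, sub_nonneg] at h
  refine le_trans ?_ h
  rw [Finset.mul_sum]
  refine Finset.sum_le_sum fun i hi => ?_
  have hi' := Finset.mem_range.1 hi
  have hp := hpos (i + 1) (by omega) (by omega)
  rw [mul_comm]
  refine mul_le_mul_of_nonneg_left ?_ (sq_nonneg _)
  have e : -w (i + 2) + 2 * w (i + 1) - w i = 2 := by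
    simp only [hw]; push_cast; ring
  rw [e]
  refine div_le_div_of_nonneg_left zero_le_two hp ?_
  simp only [hw]
  nlinarith [sq_nonneg ((N : ℝ) - ((i + 1 : ℕ) : ℝ))]

/-- The discrete parabola `N² - j²`. -/
def chainParabola (N : ℕ) : ChainDisp N := fun i => ((i : ℝ) + 1) * (2 * N - (i + 1))

theorem secondDiff_chainParabola (N : ℕ) :
    secondDiff N *ᵥ chainParabola N = fun _ => 2 := by
  have h : ∀ j : ℤ, -(N : ℤ) ≤ j → j ≤ N →
      chainVal N (chainParabola N) j = ((N : ℝ) + j) * (N - j) := by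
    intro j h1 h2
    by_cases h : -(N : ℤ) < j ∧ j < N
    · obtain ⟨i, rfl⟩ := exists_chainSite_eq h
      rw [chainVal_site, chainSite, chainParabola]
      push_cast
      ring
    · rw [chainVal_eq_zero _ h]
      obtain rfl | rfl : j = -(N : ℤ) ∨ j = N := by omega
      · push_cast; ring
      · push_cast; ring
  funext i
  have := i.isLt
  rw [secondDiff_mulVec, h _ _ _, h _ _ _, h _ _ _]
  · push_cast; ring
  all_goals simp only [chainSite]; omega

theorem sum_parabola (M : ℝ) (n : ℕ) :
    ∑ i ∈ Finset.range n, ((i : ℝ) + 1) * (2 * M - (i + 1))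
      = n * (n + 1) * (3 * M - n - 1 / 2) / 3 := by
  induction n with
  | zero => simp
  | succ n ih => rw [Finset.sum_range_succ, ih]; push_cast; ring

theorem sum_chainParabola {N : ℕ} (hN : 0 < N) :
    ∑ i, chainParabola N i = (2 * N - 1) * (2 * N) * (N + 1 / 2) / 3 := by
  have := Fin.sum_univ_eq_sum_range (fun i => ((i : ℝ) + 1) * (2 * N - (i + 1))) (2 * N - 1)
  rw [sum_parabola] at this
  rw [show ∑ i, chainParabola N i = _ from this, Nat.cast_sub (by omega)]
  push_cast
  ring

/-- The Rayleigh quotient of the parabola is at most `3 / N²`. -/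
theorem dotProduct_secondDiff_chainParabola_le {N : ℕ} (hN : 0 < N) :
    chainParabola N ⬝ᵥ (secondDiff N *ᵥ chainParabola N)
      ≤ 3 / (N : ℝ) ^ 2 * (chainParabola N ⬝ᵥ chainParabola N) := by
  have hN' : (1 : ℝ) ≤ N := by exact_mod_cast hN
  set s := ∑ i, chainParabola N i with hs
  have h1 : chainParabola N ⬝ᵥ (secondDiff N *ᵥ chainParabola N) = 2 * s := by
    rw [secondDiff_chainParabola, dotProduct, ← Finset.sum_mul, mul_comm]
  -- Cauchy–Schwarz against the constant vector replaces the exact sum of fourth powers: only the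
  -- sum `s` is needed.
  have h2 : s ^ 2 ≤ (2 * N - 1) * (chainParabola N ⬝ᵥ chainParabola N) := by
    have := sq_sum_le_card_mul_sum_sq (s := Finset.univ) (f := chainParabola N)
    rw [Finset.card_univ, Fintype.card_fin, Nat.cast_sub (by omega)] at this
    push_cast at this
    simpa [dotProduct, sq] using this
  have h3 : s = (2 * N - 1) * (2 * N) * (N + 1 / 2) / 3 := sum_chainParabola hN
  set P := chainParabola N ⬝ᵥ chainParabola N
  rw [h1, div_mul_eq_mul_div, le_div_iff₀ (by positivity)]
  have hs' : (2 * (N : ℝ) - 1) * (2 * N ^ 2) ≤ 3 * s := by rw [h3]; nlinarith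
  have hd : (0 : ℝ) < 2 * N - 1 := by linarith
  have hs0 : 0 ≤ s := by rw [h3]; positivity
  refine le_of_mul_le_mul_left ?_ hd
  calc (2 * (N : ℝ) - 1) * (2 * s * N ^ 2) = s * ((2 * N - 1) * (2 * N ^ 2)) := by ring
    _ ≤ s * (3 * s) := mul_le_mul_of_nonneg_left hs' hs0
    _ = 3 * s ^ 2 := by ring
    _ ≤ 3 * ((2 * N - 1) * P) := by linarith
    _ = (2 * N - 1) * (3 * P) := by ring

/-! ### Estimates for `B = p + m X T` with `0 ≤ T ≤ 4` and a projection `X`. -/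

theorem dotProduct_mulVec_of_isSymm {ι : Type*} [Fintype ι] {A : Matrix ι ι ℝ} (hA : A.IsSymm)
    (v w : ι → ℝ) : (A *ᵥ v) ⬝ᵥ w = v ⬝ᵥ (A *ᵥ w) := by
  rw [dotProduct_mulVec, ← mulVec_transpose, hA.eq]

theorem dotProduct_self_nonneg_real {ι : Type*} [Fintype ι] (v : ι → ℝ) : 0 ≤ v ⬝ᵥ v :=
  Finset.sum_nonneg fun i _ => mul_self_nonneg (v i)

/-- This is `T² ≤ 4T`. Testing `T ≥ 0` on `v - Tv/4` and `T ≤ 4` on `Tv` avoids any square root of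
`T`. -/
theorem mulVec_dotProduct_mulVec_le {ι : Type*} [Fintype ι] {T : Matrix ι ι ℝ} (hT : T.IsSymm)
    (h0 : ∀ v, 0 ≤ v ⬝ᵥ (T *ᵥ v)) (h4 : ∀ v, v ⬝ᵥ (T *ᵥ v) ≤ 4 * (v ⬝ᵥ v)) (v : ι → ℝ) :
    (T *ᵥ v) ⬝ᵥ (T *ᵥ v) ≤ 4 * (v ⬝ᵥ (T *ᵥ v)) := by
  have h1 := h0 (v - (1 / 4 : ℝ) • (T *ᵥ v))
  have h2 := h4 (T *ᵥ v)
  have h3 := dotProduct_mulVec_of_isSymm hT v (T *ᵥ v)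
  simp only [mulVec_sub, mulVec_smul, dotProduct_sub, sub_dotProduct, dotProduct_smul,
    smul_dotProduct, smul_eq_mul] at h1
  linarith

theorem l2_opNorm_le_four {ι : Type*} [Fintype ι] [DecidableEq ι] {T : Matrix ι ι ℝ}
    (hT : T.IsSymm) (h0 : ∀ v, 0 ≤ v ⬝ᵥ (T *ᵥ v)) (h4 : ∀ v, v ⬝ᵥ (T *ᵥ v) ≤ 4 * (v ⬝ᵥ v)) :
    ‖T‖ ≤ 4 := by
  refine l2_opNorm_le_of_dotProduct_le T (by norm_num) fun v => ?_
  have := mulVec_dotProduct_mulVec_le hT h0 h4 v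
  have := h4 v
  linarith

theorem l2_opNorm_one_add_diagonal_mul_le {ι : Type*} [Fintype ι] [DecidableEq ι]
    {T X : Matrix ι ι ℝ} {p m : ℝ} (hp : 0 < p) (hm : 0 < m) (hT : ‖T‖ ≤ 4) (hX : ‖X‖ ≤ 1) :
    ‖p • (1 : Matrix ι ι ℝ) + m • (X * T)‖ ≤ p + 4 * m := by
  have h1 : ‖(1 : Matrix ι ι ℝ)‖ ≤ 1 := l2_opNorm_le_one_of_transpose_mul_self (by simp)
  calc ‖p • (1 : Matrix ι ι ℝ) + m • (X * T)‖
      ≤ ‖p • (1 : Matrix ι ι ℝ)‖ + ‖m • (X * T)‖ := norm_add_le _ _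
    _ ≤ p * 1 + m * (1 * 4) := by
        rw [norm_smul, norm_smul, Real.norm_of_nonneg hp.le, Real.norm_of_nonneg hm.le]
        gcongr
        exact (norm_mul_le X T).trans (by gcongr)
    _ = p + 4 * m := by ring

/-- Split `g = a + b` with `a = X g`, and put `f = B g`. Off the range of `X`, `B` is just
multiplication by `p`, so `b` is controlled by `f`. Testing with `a` gives `p |a|² + m (a·Ta + a·Tb)
= a·f`, where the mixed term is absorbed by `T ≥ 0`, so `a` is controlled by `f` and `b`. The
constant depends on `p` and `m` only. -/
theorem dotProduct_self_le_of_one_add_proj_mul {ι : Type*} [Fintype ι] [DecidableEq ι]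
    {T X : Matrix ι ι ℝ} {p m : ℝ} (hp : 0 < p) (hm : 0 < m) (hT : T.IsSymm)
    (h0 : ∀ v, 0 ≤ v ⬝ᵥ (T *ᵥ v)) (h4 : ∀ v, v ⬝ᵥ (T *ᵥ v) ≤ 4 * (v ⬝ᵥ v))
    (hX : X.IsSymm) (hXX : X * X = X) (g : ι → ℝ) :
    g ⬝ᵥ g ≤ (2 / p ^ 2 + 2 * m / p ^ 3) *
      (((p • (1 : Matrix ι ι ℝ) + m • (X * T)) *ᵥ g) ⬝ᵥ
        ((p • (1 : Matrix ι ι ℝ) + m • (X * T)) *ᵥ g)) := by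
  have hf : (p • (1 : Matrix ι ι ℝ) + m • (X * T)) *ᵥ g = p • g + m • (X *ᵥ (T *ᵥ g)) := by
    rw [add_mulVec, smul_mulVec, smul_mulVec, one_mulVec, mulVec_mulVec]
  set f := (p • (1 : Matrix ι ι ℝ) + m • (X * T)) *ᵥ g
  obtain ⟨a, ha⟩ : ∃ a, a = X *ᵥ g := ⟨_, rfl⟩
  obtain ⟨b, hb⟩ : ∃ b, b = g - a := ⟨_, rfl⟩
  have hg : g = a + b := by rw [hb]; abel
  have hXa : X *ᵥ a = a := by rw [ha, mulVec_mulVec, hXX]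
  have hXb : X *ᵥ b = 0 := by rw [hb, mulVec_sub, hXa, ← ha, sub_self]
  have hab : a ⬝ᵥ b = 0 := by
    rw [← hXa, dotProduct_mulVec_of_isSymm hX, hXb, dotProduct_zero]
  have hba : b ⬝ᵥ a = 0 := by rw [dotProduct_comm, hab]
  have hgg : g ⬝ᵥ g = a ⬝ᵥ a + b ⬝ᵥ b := by
    rw [hg]; simp only [dotProduct_add, add_dotProduct, hab, hba]; ring
  have haf : a ⬝ᵥ f = p * (a ⬝ᵥ a) + m * (a ⬝ᵥ (T *ᵥ a) + a ⬝ᵥ (T *ᵥ b)) := by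
    rw [hf, dotProduct_add, dotProduct_smul, dotProduct_smul, ← dotProduct_mulVec_of_isSymm hX,
      hXa, hg, mulVec_add, dotProduct_add, dotProduct_add, hab]
    simp
  have hbf : b ⬝ᵥ f = p * (b ⬝ᵥ b) := by
    rw [hf, dotProduct_add, dotProduct_smul, dotProduct_smul, ← dotProduct_mulVec_of_isSymm hX,
      hXb, hg, dotProduct_add, hba]
    simp
  -- The weight `1/2` completes the square: `a·Ta + a·Tb ≥ -(b·Tb)/4 ≥ -|b|²`.
  have hT1 := h0 (a + (1 / 2 : ℝ) • b)
  have hTb := h4 b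
  have hTab : b ⬝ᵥ (T *ᵥ a) = a ⬝ᵥ (T *ᵥ b) := by
    rw [← dotProduct_mulVec_of_isSymm hT, dotProduct_comm]
  simp only [mulVec_add, mulVec_smul, dotProduct_add, add_dotProduct, dotProduct_smul,
    smul_dotProduct, smul_eq_mul, hTab] at hT1
  have y1 := dotProduct_self_nonneg_real (p • a - f)
  have y2 := dotProduct_self_nonneg_real (p • b - f)
  simp only [dotProduct_sub, sub_dotProduct, dotProduct_smul, smul_dotProduct, smul_eq_mul,
    dotProduct_comm f] at y1 y2
  rw [hgg]
  have k1 : p ^ 2 * (b ⬝ᵥ b) ≤ f ⬝ᵥ f := by nlinarith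
  have k2 : p ^ 2 * (a ⬝ᵥ a) ≤ f ⬝ᵥ f + 2 * m * p * (b ⬝ᵥ b) := by
    have : p * (a ⬝ᵥ a) - m * (b ⬝ᵥ b) ≤ a ⬝ᵥ f := by nlinarith
    nlinarith
  have l1 : b ⬝ᵥ b ≤ (f ⬝ᵥ f) / p ^ 2 := by
    rw [le_div_iff₀ (by positivity)]; linarith
  have l2 : a ⬝ᵥ a ≤ (f ⬝ᵥ f + 2 * m * p * ((f ⬝ᵥ f) / p ^ 2)) / p ^ 2 := by
    rw [le_div_iff₀ (by positivity)]
    have : 2 * m * p * (b ⬝ᵥ b) ≤ 2 * m * p * ((f ⬝ᵥ f) / p ^ 2) := by gcongr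
    linarith
  calc a ⬝ᵥ a + b ⬝ᵥ b ≤ (f ⬝ᵥ f + 2 * m * p * ((f ⬝ᵥ f) / p ^ 2)) / p ^ 2
        + (f ⬝ᵥ f) / p ^ 2 := add_le_add l2 l1
    _ = (2 / p ^ 2 + 2 * m / p ^ 3) * (f ⬝ᵥ f) := by field_simp; ring

/-- Boundedness below gives injectivity, hence invertibility in finite dimension. -/
theorem isUnit_det_and_l2_opNorm_inv_le {ι : Type*} [Fintype ι] [DecidableEq ι]
    {B : Matrix ι ι ℝ} {c : ℝ} (hc : 0 ≤ c)
    (h : ∀ g, g ⬝ᵥ g ≤ c * ((B *ᵥ g) ⬝ᵥ (B *ᵥ g))) :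
    IsUnit B.det ∧ ‖B⁻¹‖ ≤ √c := by
  have hu : IsUnit B.det := by
    rw [← isUnit_iff_isUnit_det, ← mulVec_injective_iff_isUnit]
    intro v w hvw
    have := h (v - w)
    simp only [mulVec_sub, show B *ᵥ v = B *ᵥ w from hvw, sub_self, dotProduct_zero,
      mul_zero] at this
    exact sub_eq_zero.1 (dotProduct_self_eq_zero.1
      (le_antisymm this (dotProduct_self_nonneg_real _)))
  refine ⟨hu, l2_opNorm_le_of_dotProduct_le _ (Real.sqrt_nonneg _) fun v => ?_⟩
  have := h (B⁻¹ *ᵥ v)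
  rwa [mulVec_mulVec _ B, mul_nonsing_inv B hu, one_mulVec, ← Real.sq_sqrt hc] at this

theorem dotProduct_mul_one_add_proj_mul {ι : Type*} [Fintype ι] [DecidableEq ι]
    {T X : Matrix ι ι ℝ} (hT : T.IsSymm) (p m : ℝ) (v : ι → ℝ) :
    v ⬝ᵥ ((T * (p • (1 : Matrix ι ι ℝ) + m • (X * T))) *ᵥ v)
      = p * (v ⬝ᵥ (T *ᵥ v)) + m * ((T *ᵥ v) ⬝ᵥ (X *ᵥ (T *ᵥ v))) := by
  rw [mul_add, mul_smul_comm, mul_smul_comm, mul_one, add_mulVec, smul_mulVec, smul_mulVec,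
    dotProduct_add, dotProduct_smul, dotProduct_smul, dotProduct_mulVec_of_isSymm hT,
    mulVec_mulVec, mulVec_mulVec, ← mul_assoc]
  rfl

theorem dotProduct_proj_bounds {ι : Type*} [Fintype ι] {X : Matrix ι ι ℝ}
    (hX : X.IsSymm) (hXX : X * X = X) (v : ι → ℝ) :
    0 ≤ v ⬝ᵥ (X *ᵥ v) ∧ v ⬝ᵥ (X *ᵥ v) ≤ v ⬝ᵥ v := by
  have e : (X *ᵥ v) ⬝ᵥ (X *ᵥ v) = v ⬝ᵥ (X *ᵥ v) := by
    rw [dotProduct_mulVec_of_isSymm hX, mulVec_mulVec, hXX]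
  have h := dotProduct_self_nonneg_real (v - X *ᵥ v)
  rw [dotProduct_sub, sub_dotProduct, sub_dotProduct, e, dotProduct_comm (X *ᵥ v)] at h
  exact ⟨e ▸ dotProduct_self_nonneg_real _, by linarith⟩

theorem isSymm_mul_one_add_proj_mul {ι : Type*} [Fintype ι] [DecidableEq ι]
    {T X : Matrix ι ι ℝ} (hT : T.IsSymm) (hX : X.IsSymm) (p m : ℝ) :
    (T * (p • (1 : Matrix ι ι ℝ) + m • (X * T))).IsSymm := by
  rw [IsSymm, mul_add, mul_smul_comm, mul_smul_comm, mul_one]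
  simp [transpose_mul, hT.eq, hX.eq, mul_assoc]

/-! ### Rayleigh quotients and the scalar Richardson problem. -/

section Rayleigh

variable {n : ℕ} {lam : Fin n → ℝ} {Q : Matrix (Fin n) (Fin n) ℝ}

theorem dotProduct_mulVec_conj_diagonal (v : Fin n → ℝ) :
    v ⬝ᵥ ((Qᵀ * diagonal lam * Q) *ᵥ v) = ∑ i, lam i * (Q *ᵥ v) i ^ 2 := by
  rw [← mulVec_mulVec, ← mulVec_mulVec, dotProduct_mulVec, vecMul_transpose]
  simp only [dotProduct, mulVec_diagonal]
  exact Finset.sum_congr rfl fun i _ => by ring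

theorem dotProduct_self_eq_sum_sq (hQ : Qᵀ * Q = 1) (v : Fin n → ℝ) :
    v ⬝ᵥ v = ∑ i, (Q *ᵥ v) i ^ 2 := by
  have := dotProduct_mulVec_conj_diagonal (lam := fun _ => 1) (Q := Q) v
  rw [diagonal_one, mul_one, hQ, one_mulVec] at this
  simpa using this

theorem mul_dotProduct_le_rayleigh (hQ : Qᵀ * Q = 1) {c : ℝ} (hc : ∀ i, c ≤ lam i)
    (v : Fin n → ℝ) : c * (v ⬝ᵥ v) ≤ v ⬝ᵥ ((Qᵀ * diagonal lam * Q) *ᵥ v) := by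
  rw [dotProduct_mulVec_conj_diagonal, dotProduct_self_eq_sum_sq hQ, Finset.mul_sum]
  exact Finset.sum_le_sum fun i _ => mul_le_mul_of_nonneg_right (hc i) (sq_nonneg _)

theorem rayleigh_le_mul_dotProduct (hQ : Qᵀ * Q = 1) {c : ℝ} (hc : ∀ i, lam i ≤ c)
    (v : Fin n → ℝ) : v ⬝ᵥ ((Qᵀ * diagonal lam * Q) *ᵥ v) ≤ c * (v ⬝ᵥ v) := by
  rw [dotProduct_mulVec_conj_diagonal, dotProduct_self_eq_sum_sq hQ, Finset.mul_sum]
  exact Finset.sum_le_sum fun i _ => mul_le_mul_of_nonneg_right (hc i) (sq_nonneg _)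

theorem exists_rayleigh_eq (hQ : Qᵀ * Q = 1) (hQ' : Q * Qᵀ = 1) (j : Fin n) :
    ∃ v : Fin n → ℝ, v ⬝ᵥ v = 1 ∧ v ⬝ᵥ ((Qᵀ * diagonal lam * Q) *ᵥ v) = lam j := by
  have h : Q *ᵥ (Qᵀ *ᵥ Pi.single j 1) = Pi.single j 1 := by
    rw [mulVec_mulVec, hQ', one_mulVec]
  refine ⟨Qᵀ *ᵥ Pi.single j 1, ?_, ?_⟩
  · rw [dotProduct_self_eq_sum_sq hQ, h]
    simp [Pi.single_apply]
  · rw [dotProduct_mulVec_conj_diagonal, h]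
    simp [Pi.single_apply]

end Rayleigh

theorem isOrderedSpectrum_of_conj {N : ℕ} {M Q : ChainMatrix N} {lam : Fin (2 * N - 1) → ℝ}
    (hlam : Monotone lam) (hQ : Q * Qᵀ = 1) (hM : M = Qᵀ * diagonal lam * Q) :
    IsOrderedSpectrum N M lam := by
  refine ⟨hlam, ?_⟩
  rw [hM, mul_assoc, charpoly_mul_comm, mul_assoc, hQ, mul_one, charpoly_diagonal]

section Richardson

variable {n : ℕ} {lam : Fin n → ℝ}

/-- `1 - α t` is monotone in `t`, so its modulus on an interval is largest at an endpoint. -/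
theorem iSup_abs_one_sub_mul_eq_max (hlam : Monotone lam) (hn : 0 < n) (α : ℝ) :
    ⨆ j, |1 - α * lam j|
      = max |1 - α * lam ⟨0, hn⟩| |1 - α * lam ⟨n - 1, by omega⟩| := by
  have : Nonempty (Fin n) := ⟨⟨0, hn⟩⟩
  have hb : BddAbove (Set.range fun j => |1 - α * lam j|) := (Set.finite_range _).bddAbove
  refine le_antisymm (ciSup_le fun j => ?_) (max_le (le_ciSup hb _) (le_ciSup hb _))
  have h1 : lam ⟨0, hn⟩ ≤ lam j := hlam (Fin.mk_le_of_le_val (Nat.zero_le _))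
  have h2 : lam j ≤ lam ⟨n - 1, by omega⟩ := hlam (Fin.le_def.2 (by have := j.isLt; simp; omega))
  rcases le_total 0 α with hα | hα
  · rw [max_comm]
    exact abs_le_max_abs_abs (by nlinarith) (by nlinarith)
  · exact abs_le_max_abs_abs (by nlinarith) (by nlinarith)

theorem max_abs_one_sub_mul_lt_one_iff {a b : ℝ} (ha : 0 < a) (hab : a ≤ b) (α : ℝ) :
    max |1 - α * a| |1 - α * b| < 1 ↔ 0 < α ∧ α < 2 / b := by
  rw [max_lt_iff, abs_lt, abs_lt, lt_div_iff₀ (ha.trans_le hab)]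
  constructor
  · rintro ⟨⟨h1, h2⟩, h3, h4⟩
    exact ⟨by by_contra! h; nlinarith, by linarith⟩
  · rintro ⟨h1, h2⟩
    refine ⟨⟨by nlinarith, by nlinarith⟩, by linarith, by nlinarith⟩

theorem max_abs_one_sub_mul_opt {a b : ℝ} (ha : 0 < a) (hab : a ≤ b) :
    max |1 - 2 / (a + b) * a| |1 - 2 / (a + b) * b| = (b - a) / (b + a) := by
  have hs : 0 < a + b := by linarith
  have e1 : 1 - 2 / (a + b) * a = (b - a) / (b + a) := by
    rw [add_comm b a]; field_simp; ring
  have e2 : 1 - 2 / (a + b) * b = -((b - a) / (b + a)) := by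
    rw [add_comm b a]; field_simp; ring
  rw [e1, e2, abs_neg, max_self, abs_of_nonneg]
  exact div_nonneg (by linarith) (by linarith)

/-- The combination `b (1 - αa) + a (αb - 1) = b - a` eliminates `α`. -/
theorem le_max_abs_one_sub_mul {a b : ℝ} (ha : 0 < a) (hab : a ≤ b) (α : ℝ) :
    (b - a) / (b + a) ≤ max |1 - α * a| |1 - α * b| := by
  have hb : 0 < b := ha.trans_le hab
  rw [div_le_iff₀ (by linarith)]
  have h1 := (le_abs_self (1 - α * a)).trans (le_max_left _ |1 - α * b|)
  have h2 := (neg_le_abs (1 - α * b)).trans (le_max_right |1 - α * a| _)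
  nlinarith

end Richardson

/-- The final inequality bounds the spectral radius by the norm, using the eigenvectors `S⁻¹ e_j`;
it makes the step-size condition necessary in `ℓ²_ε` too. -/
theorem conj_diagonal_bounds {ι : Type*} [Fintype ι] [DecidableEq ι] [Nonempty ι]
    {S M : Matrix ι ι ℝ} {lam : ι → ℝ} (hS : IsUnit S.det) (hM : M = S⁻¹ * diagonal lam * S)
    (α : ℝ) :
    ‖S * (1 - α • M) * S⁻¹‖ = ⨆ j, |1 - α * lam j| ∧
    ‖1 - α • M‖ ≤ ‖S‖ * ‖S⁻¹‖ * ⨆ j, |1 - α * lam j| ∧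
    (⨆ j, |1 - α * lam j|) ≤ ‖1 - α • M‖ := by
  set d : ι → ℝ := fun j => 1 - α * lam j
  have hd : diagonal d = 1 - α • diagonal lam := by
    ext i j
    by_cases h : i = j
    · subst h; simp [d]
    · simp [h]
  have h1 : S * (1 - α • M) * S⁻¹ = diagonal d := by
    have : S * M * S⁻¹ = diagonal lam := by
      rw [hM, ← mul_assoc, ← mul_assoc, mul_nonsing_inv S hS, one_mul, mul_assoc,
        mul_nonsing_inv S hS, mul_one]
    rw [mul_sub, sub_mul, mul_one, mul_nonsing_inv S hS, mul_smul_comm, smul_mul_assoc, this, hd]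
  have h2 : 1 - α • M = S⁻¹ * diagonal d * S := by
    rw [← h1, mul_assoc, mul_assoc, nonsing_inv_mul S hS, mul_one, ← mul_assoc,
      nonsing_inv_mul S hS, one_mul]
  refine ⟨by rw [h1, l2_opNorm_diagonal, iSup_abs_eq_norm], ?_, ciSup_le fun j => ?_⟩
  · rw [h2, iSup_abs_eq_norm, ← l2_opNorm_diagonal]
    calc ‖S⁻¹ * diagonal d * S‖ ≤ ‖S⁻¹‖ * ‖diagonal d‖ * ‖S‖ :=
          (norm_mul_le _ _).trans (by gcongr; exact norm_mul_le _ _)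
      _ = ‖S‖ * ‖S⁻¹‖ * ‖diagonal d‖ := by ring
  · set v : ι → ℝ := S⁻¹ *ᵥ Pi.single j 1
    have hv : v ≠ 0 := fun h => by
      have : S *ᵥ v = 0 := by rw [h, mulVec_zero]
      rw [mulVec_mulVec, mul_nonsing_inv S hS, one_mulVec] at this
      simpa using congrFun this j
    have hGv : (1 - α • M) *ᵥ v = d j • v := by
      rw [h2, mulVec_mulVec, mul_assoc _ S, mul_nonsing_inv S hS, mul_one, ← mulVec_mulVec,
        diagonal_mulVec_single, mul_one, ← mulVec_smul, ← Pi.single_smul, smul_eq_mul, mul_one]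
    have := norm_toLp_mulVec_le (1 - α • M) v
    rw [hGv, WithLp.toLp_smul, norm_smul] at this
    exact le_of_mul_le_mul_right this (norm_toLp_pos hv)

/-! ### Diagonalization of `L^qcf` and the extreme eigenvalues of `L^qnl`. -/

theorem atomisticProj_isSymm (N K : ℕ) : (atomisticProj N K).IsSymm := isSymm_diagonal _

theorem atomisticProj_mul_self (N K : ℕ) :
    atomisticProj N K * atomisticProj N K = atomisticProj N K := by
  rw [atomisticProj, diagonal_mul_diagonal]
  congr 1
  funext i
  split_ifs <;> simp

theorem l2_opNorm_atomisticProj_le (N K : ℕ) : ‖atomisticProj N K‖ ≤ 1 := by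
  rw [atomisticProj, l2_opNorm_diagonal]
  refine (pi_norm_le_iff_of_nonneg zero_le_one).2 fun i => ?_
  split_ifs <;> simp

theorem secondDiff_nonneg {N : ℕ} (hN : 0 < N) (v : ChainDisp N) :
    0 ≤ v ⬝ᵥ (secondDiff N *ᵥ v) :=
  (mul_nonneg (by positivity) (dotProduct_self_nonneg_real v)).trans (le_dotProduct_secondDiff hN v)

/-- The bound of the condition number of the similarity between `L^qcf` and the diagonal matrix of
the eigenvalues. -/
def condBound (phiF phi2F : ℝ) : ℝ :=
  phiF * √(2 / elasticModulus phiF phi2F ^ 2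
    + 2 * (-phi2F) / elasticModulus phiF phi2F ^ 3)

theorem condBound_pos {phiF phi2F : ℝ} (hphiF : 0 < phiF) (hphi2F : phi2F < 0)
    (hA : 0 < elasticModulus phiF phi2F) : 0 < condBound phiF phi2F := by
  have : 0 < -phi2F := by linarith
  unfold condBound
  positivity

/-- The witness is `S = Q B⁻¹`, with inverse `B Qᵀ`. The two factors of `condBound` bound `‖B‖` and
`‖B⁻¹‖`. -/
theorem exists_qcf_diagonalization {phiF phi2F : ℝ} (hphi2F : phi2F < 0)
    (hA : 0 < elasticModulus phiF phi2F) {N K : ℕ} (hK : 1 ≤ K) (hKN : K + 2 ≤ N) :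
    ∃ (lam : Fin (2 * N - 1) → ℝ) (Q S : ChainMatrix N), Monotone lam ∧ Qᵀ * Q = 1 ∧
      Q * Qᵀ = 1 ∧ qnlMatrix phiF phi2F N K = Qᵀ * diagonal lam * Q ∧ IsUnit S.det ∧
      qcfMatrix phiF phi2F N K = S⁻¹ * diagonal lam * S ∧ ‖S‖ * ‖S⁻¹‖ ≤ condBound phiF phi2F := by
  have hN : 0 < N := by omega
  have hm : 0 < -phi2F := by linarith
  have hT := secondDiff_isSymm N
  have hT0 := secondDiff_nonneg hN
  have hT4 := dotProduct_secondDiff_le hN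
  have hX := atomisticProj_isSymm N K
  have hXX := atomisticProj_mul_self N K
  have hqcf := qcfMatrix_eq phiF phi2F hKN
  have hqnl := qnlMatrix_eq phiF phi2F hK hKN
  have hB1 := l2_opNorm_one_add_diagonal_mul_le hA hm (l2_opNorm_le_four hT hT0 hT4)
    (l2_opNorm_atomisticProj_le N K)
  obtain ⟨hBu, hB2⟩ := isUnit_det_and_l2_opNorm_inv_le (by positivity)
    (dotProduct_self_le_of_one_add_proj_mul hA hm hT hT0 hT4 hX hXX)
  have hsymm : (qnlMatrix phiF phi2F N K).IsSymm := by
    rw [hqnl]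
    exact (isSymm_mul_one_add_proj_mul hT hX _ _).smul _
  obtain ⟨lam, Q, hlam, hQ, hQ', hH⟩ := exists_monotone_orthogonal_diagonalization hsymm
  set B := elasticModulus phiF phi2F • (1 : ChainMatrix N)
    + (-phi2F) • (atomisticProj N K * secondDiff N)
  have hleft : B * Qᵀ * (Q * B⁻¹) = 1 := by
    rw [mul_assoc, ← mul_assoc Qᵀ, hQ, one_mul, mul_nonsing_inv B hBu]
  have hinv : (Q * B⁻¹)⁻¹ = B * Qᵀ := inv_eq_left_inv hleft
  have hQn : ‖Q‖ ≤ 1 := l2_opNorm_le_one_of_transpose_mul_self hQ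
  have hQn' : ‖Qᵀ‖ ≤ 1 := l2_opNorm_le_one_of_transpose_mul_self (by simpa using hQ')
  refine ⟨lam, Q, Q * B⁻¹, hlam, hQ, hQ', hH, isUnit_det_of_left_inverse hleft, ?_, ?_⟩
  · have e : B * Qᵀ * diagonal lam * (Q * B⁻¹) = B * (Qᵀ * diagonal lam * Q) * B⁻¹ := by
      simp only [mul_assoc]
    rw [hinv, e, ← hH, hqcf, hqnl, mul_smul_comm, smul_mul_assoc, mul_assoc, mul_assoc (secondDiff N),
      mul_nonsing_inv B hBu, mul_one]
  · rw [hinv, condBound, mul_comm]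
    have hp : elasticModulus phiF phi2F + 4 * -phi2F = phiF := by
      unfold elasticModulus; ring
    rw [hp] at hB1
    refine mul_le_mul ?_ ?_ (norm_nonneg _) ((norm_nonneg _).trans hB1)
    · calc ‖B * Qᵀ‖ ≤ ‖B‖ * ‖Qᵀ‖ := norm_mul_le _ _
        _ ≤ phiF * 1 := mul_le_mul hB1 hQn' (norm_nonneg _) ((norm_nonneg _).trans hB1)
        _ = phiF := mul_one _
    · calc ‖Q * B⁻¹‖ ≤ ‖Q‖ * ‖B⁻¹‖ := norm_mul_le _ _
        _ ≤ 1 * _ := mul_le_mul hQn hB2 (norm_nonneg _) zero_le_one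
        _ = _ := one_mul _

/-- The term `m (Tv · X T v)` lies between `0` and `m |Tv|² ≤ 4m (v · Tv)`, and `p + 4m = φ''_F`. -/
theorem qnl_form_bounds {phiF phi2F : ℝ} (hphi2F : phi2F < 0) {N K : ℕ} (hK : 1 ≤ K)
    (hKN : K + 2 ≤ N) (v : ChainDisp N) :
    (N : ℝ) ^ 2 * (elasticModulus phiF phi2F * (v ⬝ᵥ (secondDiff N *ᵥ v)))
        ≤ v ⬝ᵥ (qnlMatrix phiF phi2F N K *ᵥ v) ∧
      v ⬝ᵥ (qnlMatrix phiF phi2F N K *ᵥ v)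
        ≤ (N : ℝ) ^ 2 * (phiF * (v ⬝ᵥ (secondDiff N *ᵥ v))) := by
  have hN : 0 < N := by omega
  have hT := secondDiff_isSymm N
  rw [qnlMatrix_eq phiF phi2F hK hKN, smul_mulVec, dotProduct_smul, smul_eq_mul,
    dotProduct_mul_one_add_proj_mul hT]
  obtain ⟨h1, h2⟩ := dotProduct_proj_bounds (atomisticProj_isSymm N K)
    (atomisticProj_mul_self N K) (secondDiff N *ᵥ v)
  have h3 := mulVec_dotProduct_mulVec_le hT (secondDiff_nonneg hN) (dotProduct_secondDiff_le hN) v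
  constructor
  · refine mul_le_mul_of_nonneg_left ?_ (by positivity)
    nlinarith
  · refine mul_le_mul_of_nonneg_left ?_ (by positivity)
    unfold elasticModulus
    nlinarith

theorem qnl_eigenvalue_bounds {phiF phi2F : ℝ} (hphiF : 0 < phiF) (hphi2F : phi2F < 0)
    (hA : 0 < elasticModulus phiF phi2F) {N K : ℕ} (hK : 1 ≤ K) (hKN : K + 2 ≤ N)
    {lam : Fin (2 * N - 1) → ℝ} {Q : ChainMatrix N} (hQ : Qᵀ * Q = 1) (hQ' : Q * Qᵀ = 1)
    (hH : qnlMatrix phiF phi2F N K = Qᵀ * diagonal lam * Q) (j : Fin (2 * N - 1)) :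
    2 * elasticModulus phiF phi2F ≤ lam j ∧ lam j ≤ 4 * phiF * (N : ℝ) ^ 2 := by
  have hN : 0 < N := by omega
  have hN' : (0 : ℝ) < (N : ℝ) ^ 2 := by positivity
  obtain ⟨v, hv, hvj⟩ := exists_rayleigh_eq (lam := lam) hQ hQ' j
  obtain ⟨h1, h2⟩ := qnl_form_bounds (phiF := phiF) hphi2F hK hKN v
  rw [hH, hvj] at h1 h2
  have h3 := le_dotProduct_secondDiff hN v
  have h4 := dotProduct_secondDiff_le hN v
  rw [hv, mul_one] at h3 h4
  rw [div_le_iff₀ hN'] at h3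
  constructor
  · nlinarith
  · refine h2.trans ?_
    have : phiF * (v ⬝ᵥ (secondDiff N *ᵥ v)) ≤ phiF * 4 := mul_le_mul_of_nonneg_left h4 hphiF.le
    nlinarith

theorem qnl_lowest_eigenvalue_le {phiF phi2F : ℝ} (hphiF : 0 < phiF) (hphi2F : phi2F < 0)
    {N K : ℕ} (hK : 1 ≤ K) (hKN : K + 2 ≤ N)
    {lam : Fin (2 * N - 1) → ℝ} {Q : ChainMatrix N} (hQ : Qᵀ * Q = 1)
    (hH : qnlMatrix phiF phi2F N K = Qᵀ * diagonal lam * Q) {a : ℝ} (ha : ∀ j, a ≤ lam j) :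
    a ≤ 3 * phiF := by
  have hN : 0 < N := by omega
  have hN' : (0 : ℝ) < (N : ℝ) ^ 2 := by positivity
  have h1 := mul_dotProduct_le_rayleigh hQ ha (chainParabola N)
  rw [← hH] at h1
  have h2 := (qnl_form_bounds (phiF := phiF) hphi2F hK hKN (chainParabola N)).2
  have h3 := dotProduct_secondDiff_chainParabola_le hN
  have hpos : 0 < chainParabola N ⬝ᵥ chainParabola N := by
    refine lt_of_le_of_ne (dotProduct_self_nonneg_real _) fun h => ?_
    have h0 := congrFun (dotProduct_self_eq_zero.1 h.symm) ⟨0, by omega⟩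
    have hN1 : (1 : ℝ) ≤ N := by exact_mod_cast hN
    simp only [chainParabola, Nat.cast_zero, zero_add, Pi.zero_apply] at h0
    linarith
  refine le_of_mul_le_mul_right (h1.trans (h2.trans ?_)) hpos
  calc (N : ℝ) ^ 2 * (phiF * (chainParabola N ⬝ᵥ (secondDiff N *ᵥ chainParabola N)))
      ≤ (N : ℝ) ^ 2 * (phiF * (3 / (N : ℝ) ^ 2 * (chainParabola N ⬝ᵥ chainParabola N))) := by
        gcongr
    _ = 3 * phiF * (chainParabola N ⬝ᵥ chainParabola N) := by field_simp

theorem le_qnl_highest_eigenvalue {phiF phi2F : ℝ} (hphi2F : phi2F < 0)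
    {N K : ℕ} (hK : 1 ≤ K) (hKN : K + 2 ≤ N)
    {lam : Fin (2 * N - 1) → ℝ} {Q : ChainMatrix N} (hQ : Qᵀ * Q = 1)
    (hH : qnlMatrix phiF phi2F N K = Qᵀ * diagonal lam * Q) {b : ℝ} (hb : ∀ j, lam j ≤ b) :
    2 * elasticModulus phiF phi2F * (N : ℝ) ^ 2 ≤ b := by
  -- A unit vector at one atom has Rayleigh quotient `2` for `T`; the leftmost free atom has only
  -- one free neighbour to check.
  set i : Fin (2 * N - 1) := ⟨0, by omega⟩ with hi
  have h1 := rayleigh_le_mul_dotProduct hQ hb (Pi.single i 1)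
  rw [← hH] at h1
  have h2 := (qnl_form_bounds (phiF := phiF) hphi2F hK hKN (Pi.single i 1)).1
  have h3 : (Pi.single i 1 : ChainDisp N) ⬝ᵥ (secondDiff N *ᵥ Pi.single i 1) = 2 := by
    have hne : chainVal N (Pi.single i 1) (chainSite N i + 1) = 0 := by
      have : chainSite N i + 1 = chainSite N ⟨1, by omega⟩ := by simp [chainSite, hi]; ring
      rw [this, chainVal_site, Pi.single_apply, if_neg (by simp [hi])]
    have hne' : chainVal N (Pi.single i 1) (chainSite N i - 1) = 0 :=
      chainVal_eq_zero _ (by simp [chainSite, hi])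
    rw [single_one_dotProduct, secondDiff_mulVec, hne, hne', chainVal_site]
    simp
  rw [h3] at h2
  simp at h1
  simp at h2
  linarith

end

/-! ### Assembly of the contraction and rate estimates. -/

theorem mainTheorem8 (phiF phi2F : ℝ) (hphiF : 0 < phiF) (hphi2F : phi2F < 0)
    (hA : 0 < elasticModulus phiF phi2F) :
    ∃ C : ℝ, 0 < C ∧ ∀ (N K : ℕ) (_ : 1 ≤ K) (hKN : K + 2 ≤ N),
      ∃ (lam : Fin (2 * N - 1) → ℝ) (S : ChainMatrix N),
        IsOrderedSpectrum N (qnlMatrix phiF phi2F N K) lam ∧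
        (∀ j, 0 < lam j) ∧
        IsUnit S.det ∧
        qcfMatrix phiF phi2F N K = S⁻¹ * Matrix.diagonal lam * S ∧
        epsCond N S ≤ C ∧
        (∀ α : ℝ,
          opNormOf N (energyNorm N (S.transpose * S)) (richardsonMatrix phiF phi2F N K α)
              = ⨆ j, |1 - α * lam j| ∧
          opNormOf N (epsNorm N) (richardsonMatrix phiF phi2F N K α)
              ≤ epsCond N S * ⨆ j, |1 - α * lam j| ∧
          opNormOf N (epsNorm N) (richardsonMatrix phiF phi2F N K α)
              ≤ C * ⨆ j, |1 - α * lam j|) ∧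
        (∀ lam₁ lamMax : ℝ, lam₁ = lam ⟨0, by omega⟩ → lamMax = lam ⟨2 * N - 2, by omega⟩ →
          (∀ α : ℝ,
            opNormOf N (energyNorm N (S.transpose * S)) (richardsonMatrix phiF phi2F N K α) < 1
              ↔ 0 < α ∧ α < 2 / lamMax) ∧
          (∀ α : ℝ,
            opNormOf N (epsNorm N) (richardsonMatrix phiF phi2F N K α) < 1
              → 0 < α ∧ α < 2 / lamMax) ∧
          (∀ αopt q : ℝ, αopt = 2 / (lam₁ + lamMax) →
            q = (lamMax - lam₁) / (lamMax + lam₁) →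
            opNormOf N (energyNorm N (S.transpose * S))
                (richardsonMatrix phiF phi2F N K αopt) = q ∧
            (∀ α : ℝ, q ≤ opNormOf N (energyNorm N (S.transpose * S))
                (richardsonMatrix phiF phi2F N K α)) ∧
            opNormOf N (epsNorm N) (richardsonMatrix phiF phi2F N K αopt) ≤ C * q ∧
            opNormOf N (epsNorm N) (richardsonMatrix phiF phi2F N K αopt)
              ≤ C * (1 - 2 * elasticModulus phiF phi2F * latticeEps N ^ 2 / phiF) ∧
            1 - C * latticeEps N ^ 2 ≤ q ∧
            q ≤ 1 - elasticModulus phiF phi2F * latticeEps N ^ 2 / (2 * phiF))) := by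
  have hκ := condBound_pos hphiF hphi2F hA
  have hp : elasticModulus phiF phi2F < phiF := by unfold elasticModulus; linarith
  set p := elasticModulus phiF phi2F
  set κ := condBound phiF phi2F
  have hpF : 0 < 3 * phiF / p := by positivity
  -- The `2κ` pays for a factor that is only known to be at least `1/2`; `3φ''_F / p` serves the
  -- lower bound of `q`.
  refine ⟨2 * κ + 3 * phiF / p, by positivity, fun N K hK hKN => ?_⟩
  have hN : 0 < N := by omega
  have hn : 0 < 2 * N - 1 := by omega
  have : Nonempty (Fin (2 * N - 1)) := ⟨⟨0, hn⟩⟩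
  obtain ⟨lam, Q, S, hlam, hQ, hQ', hH, hS, hM, hc⟩ :=
    exists_qcf_diagonalization hphi2F hA hK hKN
  have hbd := qnl_eigenvalue_bounds hphiF hphi2F hA hK hKN hQ hQ' hH
  have hcond : epsCond N S = ‖S‖ * ‖S⁻¹‖ := by
    rw [epsCond, opNormOf_epsNorm hN, opNormOf_epsNorm hN]
  have hconj := conj_diagonal_bounds hS hM
  have hen : ∀ α, opNormOf N (energyNorm N (S.transpose * S)) (richardsonMatrix phiF phi2F N K α)
      = ⨆ j, |1 - α * lam j| := fun α => by
    rw [opNormOf_energyNorm hN hS]; exact (hconj α).1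
  have heps : ∀ α, opNormOf N (epsNorm N) (richardsonMatrix phiF phi2F N K α)
      ≤ κ * ⨆ j, |1 - α * lam j| := fun α => by
    rw [opNormOf_epsNorm hN]
    exact (hconj α).2.1.trans
      (mul_le_mul_of_nonneg_right hc (Real.iSup_nonneg fun j => abs_nonneg _))
  have hC : κ ≤ 2 * κ + 3 * phiF / p := by linarith
  refine ⟨lam, S, isOrderedSpectrum_of_conj hlam hQ' hH, fun j => by have := (hbd j).1; linarith,
    hS, hM, by rw [hcond]; exact hc.trans hC, fun α => ⟨hen α, ?_, ?_⟩, ?_⟩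
  · rw [hcond, opNormOf_epsNorm hN]; exact (hconj α).2.1
  · exact (heps α).trans
      (mul_le_mul_of_nonneg_right hC (Real.iSup_nonneg fun j => abs_nonneg _))
  intro a b ha hb
  have hmax := iSup_abs_one_sub_mul_eq_max hlam hn
  have hlast : (⟨2 * N - 1 - 1, by omega⟩ : Fin (2 * N - 1)) = ⟨2 * N - 2, by omega⟩ :=
    Fin.ext (by simp only; omega)
  simp only [hlast, ← ha, ← hb] at hmax
  have haj : ∀ j, a ≤ lam j := fun j => ha ▸ hlam (Fin.mk_le_of_le_val (Nat.zero_le _))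
  have hbj : ∀ j, lam j ≤ b := fun j => hb ▸ hlam (Fin.le_def.2 (by have := j.isLt; simp; omega))
  have ha1 : 2 * p ≤ a := ha ▸ (hbd _).1
  have hb1 : b ≤ 4 * phiF * (N : ℝ) ^ 2 := hb ▸ (hbd _).2
  have ha2 := qnl_lowest_eigenvalue_le hphiF hphi2F hK hKN hQ hH haj
  have hb2 : 2 * p * (N : ℝ) ^ 2 ≤ b := le_qnl_highest_eigenvalue hphi2F hK hKN hQ hH hbj
  have hab : a ≤ b := ha ▸ hbj _
  have ha0 : 0 < a := by linarith
  have hb0 : 0 < b := by linarith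
  refine ⟨fun α => ?_, fun α hα => ?_, ?_⟩
  · rw [hen, hmax]; exact max_abs_one_sub_mul_lt_one_iff ha0 hab α
  · rw [opNormOf_epsNorm hN] at hα
    rw [← max_abs_one_sub_mul_lt_one_iff ha0 hab, ← hmax]
    exact (hconj α).2.2.trans_lt hα
  rintro _ q rfl hq
  have hopt : ⨆ j, |1 - 2 / (a + b) * lam j| = q := by
    rw [hmax, hq]; exact max_abs_one_sub_mul_opt ha0 hab
  have hq0 : 0 ≤ q := by rw [hq]; exact div_nonneg (by linarith) (by linarith)
  have hq1 : q = 1 - 2 * a / (b + a) := by rw [hq]; field_simp; ring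
  have hqle : q ≤ 1 := by
    have : 0 ≤ 2 * a / (b + a) := by positivity
    linarith
  have hG := heps (2 / (a + b))
  rw [hopt] at hG
  have hN3 : (3 : ℝ) ≤ N := by exact_mod_cast (show 3 ≤ N by omega)
  have hN9 : (9 : ℝ) ≤ (N : ℝ) ^ 2 := by nlinarith
  have hε : latticeEps N ^ 2 = 1 / (N : ℝ) ^ 2 := by rw [latticeEps]; simp
  refine ⟨by rw [hen, hopt], fun α => ?_, hG.trans (mul_le_mul_of_nonneg_right hC hq0), ?_, ?_, ?_⟩
  · rw [hen, hmax, hq]; exact le_max_abs_one_sub_mul ha0 hab α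
  -- As `p < φ''_F` and `N ≥ 3`, the factor is at least `1/2`, so `κ q ≤ κ` and the `2κ` in the
  -- constant already suffice.
  · have h1 : 1 / 2 ≤ 1 - 2 * p * latticeEps N ^ 2 / phiF := by
      have : 2 * p * latticeEps N ^ 2 / phiF ≤ 1 / 2 := by
        rw [hε, div_le_iff₀ hphiF, mul_one_div, div_le_iff₀ (by positivity)]
        nlinarith
      linarith
    calc opNormOf N (epsNorm N) (richardsonMatrix phiF phi2F N K (2 / (a + b)))
        ≤ κ * q := hG
      _ ≤ κ * 1 := mul_le_mul_of_nonneg_left hqle hκ.le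
      _ ≤ (2 * κ + 3 * phiF / p) * (1 / 2) := by linarith
      _ ≤ _ := mul_le_mul_of_nonneg_left h1 (by positivity)
  -- Here `1 - q = 2a/(b + a)` is bounded above by `a ≤ 3φ''_F` and `b ≥ 2p N²`.
  · have h1 : 2 * a / (b + a) ≤ 3 * phiF / p * latticeEps N ^ 2 := by
      calc 2 * a / (b + a) ≤ 2 * (3 * phiF) / (2 * p * (N : ℝ) ^ 2) := by
            gcongr; linarith
        _ = 3 * phiF / p * latticeEps N ^ 2 := by rw [hε]; field_simp
    have h2 : 0 ≤ 2 * κ * latticeEps N ^ 2 := by positivity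
    rw [hq1]
    nlinarith
  -- After clearing denominators the claim is `p (a + b) ≤ 4 φ''_F N² a`. The bounds on `b` and `a`
  -- give `p b ≤ 2 φ''_F N² a`, and `p a ≤ φ''_F N² a`.
  · have h1 : p * latticeEps N ^ 2 / (2 * phiF) ≤ 2 * a / (b + a) := by
      rw [hε, mul_one_div, div_div, div_le_div_iff₀ (by positivity) (by positivity)]
      have e1 : p * b ≤ p * (4 * phiF * (N : ℝ) ^ 2) := mul_le_mul_of_nonneg_left hb1 hA.le
      have e2 : p * a ≤ (N : ℝ) ^ 2 * phiF * a := by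
        refine mul_le_mul_of_nonneg_right ?_ ha0.le
        nlinarith
      have e3 : (2 * p) * ((N : ℝ) ^ 2 * phiF) ≤ a * ((N : ℝ) ^ 2 * phiF) :=
        mul_le_mul_of_nonneg_right ha1 (by positivity)
      nlinarith
    linarith
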